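/- For $\tau\in\mathbb{R}$ define $$\mathcal{J}_\tau(y)=\sum_{m=1}^{\infty}\sum_{n=1}^{\infty}\left(\frac{n}{m}\right)^{\tau}e^{-2\pi mny}\quad(y>0),\qquad \eta_\tau(y)=\frac{(y+\sqrt{y^2-1})^{\tau}+(y+\sqrt{y^2-1})^{-\tau}}{\sqrt{y^2-1}}\quad(y>1).$$ Then the following hold. (a) For every $\tau\in(0,\tfrac12)$ the double series defining $\mathcal{J}_\tau(y)$ converges absolutely for each $y>0$, $\mathcal{J}_\tau$ is three times continuously differentiable on $(0,\infty)$, and for every $t\in\mathbb{R}$ the integrals in the inequality below converge absolutely. (b) The Riemann hypothesis (every nontrivial zero of the Riemann zeta function has real part $\tfrac12$) holds if and only if, for every $\tau\in(0,\tfrac12)$ and every $t\in\mathbb{R}$, $$\begin{aligned} 0<{}&4\left[\left(t^2+\tau^2+\tfrac14\right)^2-\tau^2\right]\int_1^\infty\!\int_1^\infty\cos(2t\ln x)\,\mathcal{J}_\tau(x^2y)\,\eta_\tau(y)\,dx\,dy\\ &+\left(t^2+2\tau^2+\tfrac14\right)\int_1^\infty\left[2y\mathcal{J}_\tau'(y)+\mathcal{J}_\tau(y)\right]\eta_\tau(y)\,dy\\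 &-\int_1^\infty y\left[2y^2\mathcal{J}_\tau'''(y)+9y\mathcal{J}_\tau''(y)+6\mathcal{J}_\tau'(y)\right]\eta_\tau(y)\,dy. \end{aligned}$$ -/

import Mathlib

/-- The double series `𝒥_τ(y) = ∑_{m ≥ 1} ∑_{n ≥ 1} (n / m) ^ τ * exp (-2 π m n y)`;
meaningful for `y > 0`. -/
noncomputable def calJ (τ y : ℝ) : ℝ :=
  ∑' m : ℕ+, ∑' n : ℕ+, ((n : ℝ) / (m : ℝ)) ^ τ * Real.exp (-2 * Real.pi * m * n * y)

/-- The weight `η_τ(y) = ((y + √(y² - 1)) ^ τ + (y + √(y² - 1)) ^ (-τ)) / √(y² - 1)`;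
meaningful for `y > 1`. -/
noncomputable def etaWeight (τ y : ℝ) : ℝ :=
  ((y + Real.sqrt (y ^ 2 - 1)) ^ τ + (y + Real.sqrt (y ^ 2 - 1)) ^ (-τ)) /
    Real.sqrt (y ^ 2 - 1)

/-- The integrand `cos (2 t ln x) 𝒥_τ(x² y) η_τ(y)` of the double integral, at `p = (x, y)`. -/
noncomputable def kernelA (τ t : ℝ) (p : ℝ × ℝ) : ℝ :=
  Real.cos (2 * t * Real.log p.1) * calJ τ (p.1 ^ 2 * p.2) * etaWeight τ p.2

/-- The integrand `[2 y 𝒥_τ'(y) + 𝒥_τ(y)] η_τ(y)`. -/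
noncomputable def kernelB (τ y : ℝ) : ℝ :=
  (2 * y * deriv (calJ τ) y + calJ τ y) * etaWeight τ y

/-- The integrand `y [2 y² 𝒥_τ'''(y) + 9 y 𝒥_τ''(y) + 6 𝒥_τ'(y)] η_τ(y)`. -/
noncomputable def kernelC (τ y : ℝ) : ℝ :=
  y * (2 * y ^ 2 * iteratedDeriv 3 (calJ τ) y + 9 * y * iteratedDeriv 2 (calJ τ) y +
    6 * deriv (calJ τ) y) * etaWeight τ y

open Real Complex Set MeasureTheory Filter Topology HurwitzZeta ComplexConjugate

/-! The right-hand side of the criterion equals `((1/2+τ)²+t²)((1/2-τ)²+t²)/2 · |Λ(1/2+τ+it)|²`,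
with `Λ` the completed zeta function (`criterion_eq_normSq`). It is therefore positive for all `τ`,
`t` exactly when `Λ` has no zero with `1/2 < Re s < 1`; by `Λ(1-s) = Λ(s)` and non-vanishing of zeta
on `Re s ≥ 1`, this is the Riemann hypothesis.

For the identity, let `ψ(u) = ∑ exp(-πn²u)`. Then `φ(u) = ψ(u) - u^(-1/2)/2` has Mellin transform
`Λ(2s)` on `0 < Re s < 1/2` (`hasMellin_reducedTheta`). Since `|Λ(1/2+τ+it)|² = Λ(1/2+τ+it)
Λ(1/2-τ+it)`, it is, up to a factor 2, the Fourier transform of a convolution `K` of two weighted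
copies of `φ` (`integral_exp_mul_zetaKernel`), and the theta functional equation makes `K` even
(`zetaKernel_neg`).

Expanding `φφ`, the `ψψ` part is the integral of `𝒥_τ` against `η_τ` (`coshIntegral_zero_eq`); the
rest is two exponentials with unevaluated coefficients `α`, `β` (`zetaKernel_eq`). Evenness gives
`K'(0) = K'''(0) = 0`, two linear relations (`coshIntegral_relations`) that eliminate `α` and `β`
and bring in the single integrals with derivatives of `𝒥_τ`. -/

/-! ### The theta function and its Mellin transform -/

/-- Half of the Jacobi theta function without its constant term. -/
noncomputable def halfTheta (u : ℝ) : ℝ := (evenKernel 0 u - 1) / 2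

/-- `halfTheta` minus its leading term `u ^ (-1/2) / 2` at `0`. -/
noncomputable def reducedTheta (u : ℝ) : ℝ := halfTheta u - u ^ (-(1 / 2) : ℝ) / 2

lemma hasSum_halfTheta {u : ℝ} (hu : 0 < u) :
    HasSum (fun n : ℕ+ => rexp (-π * (n : ℝ) ^ 2 * u)) (halfTheta u) := by
  have h := (hasSum_nat_cosKernel₀ 0 hu).div_const 2
  have h2 := (Equiv.hasSum_iff Equiv.pnatEquivNat).mpr h
  rw [halfTheta, evenKernel_eq_cosKernel_of_zero, ← QuotientAddGroup.mk_zero]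
  refine h2.congr_fun fun n => ?_
  simp [Equiv.pnatEquivNat, PNat.natPred]

/-- Jacobi's `θ(1/u) = √u θ(u)`: the two terms subtracted from `θ/2`, namely `1/2` and `u^(-1/2)/2`,
are exchanged by it. -/
lemma reducedTheta_exp_neg (r : ℝ) :
    reducedTheta (rexp (-r)) = rexp (r / 2) * reducedTheta (rexp r) := by
  have h := evenKernel_functional_equation 0 (rexp (-r))
  rw [← evenKernel_eq_cosKernel_of_zero, one_div (rexp (-r)), ← Real.exp_neg, neg_neg,
    ← Real.exp_mul] at h
  simp only [reducedTheta, halfTheta, h, ← Real.exp_mul, one_div, ← Real.exp_neg]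
  have e : rexp (r / 2) * rexp (r * -2⁻¹) = 1 := by
    rw [← Real.exp_add]; simp; ring
  have e2 : -(-r * 2⁻¹) = r / 2 := by ring
  have e3 : -r * -2⁻¹ = r / 2 := by ring
  rw [e2, e3]
  have e4 : r * -2⁻¹ = -(r / 2) := by ring
  rw [e4] at e ⊢
  linear_combination e / 2

lemma continuousOn_halfTheta : ContinuousOn halfTheta (Ioi 0) :=
  ((continuousOn_evenKernel 0).sub continuousOn_const).div_const 2

lemma mellinConvergent_halfTheta {s : ℂ} (hs : 1 / 2 < s.re) :
    MellinConvergent (fun u => (halfTheta u : ℂ)) s := by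
  have h := ((hurwitzEvenFEPair 0).hasMellin (s := s) hs).1
  refine (h.const_smul (1 / 2 : ℂ)).congr_fun ?_ measurableSet_Ioi
  intro x hx
  simp only [halfTheta, hurwitzEvenFEPair, Function.comp_apply, if_true, smul_eq_mul]
  push_cast
  ring

/-- Away from `u = 1`, twice the function is `f_modif` (whose transform is the entire `Λ₀`) minus
`1` on `(0, 1]` and minus `u^(-1/2)` on `(1, ∞)`. These corrections converge for `Re s > 0` and `Re
s < 1/2` and supply the two polar terms of `Λ`. -/
lemma hasMellin_reducedTheta {s : ℂ} (h0 : 0 < s.re) (h1 : s.re < 1 / 2) :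
    HasMellin (fun u => (reducedTheta u : ℂ)) s (completedRiemannZeta (2 * s)) := by
  set P := hurwitzEvenFEPair 0 with hP
  have hA : HasMellin P.f_modif s (P.Λ₀ s) :=
    ⟨(P.isStrongFEPair_toStrongFEPair.hasMellin s).1, rfl⟩
  have hB := hasMellin_one_Ioc h0
  have hre : (s - 3 / 2).re < -1 := by
    simp only [sub_re, div_ofNat_re, re_ofNat]; linarith
  have key : ∀ x ∈ Ioi (0 : ℝ), (x : ℂ) ^ (s - 1) •
      indicator (Ioi (1 : ℝ)) (fun t : ℝ => (t : ℂ) ^ (-(1 / 2) : ℂ)) x =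
      indicator (Ioi (1 : ℝ)) (fun t : ℝ => (t : ℂ) ^ (s - 3 / 2)) x := by
    intro x hx
    by_cases h : x ∈ Ioi (1 : ℝ)
    · rw [indicator_of_mem h, indicator_of_mem h, smul_eq_mul,
        ← cpow_add _ _ (ofReal_ne_zero.mpr (ne_of_gt hx))]
      congr 1; ring
    · simp [indicator_of_notMem h]
  have hC : HasMellin (indicator (Ioi (1 : ℝ)) (fun t : ℝ => (t : ℂ) ^ (-(1 / 2) : ℂ))) s
      (1 / (1 / 2 - s)) := by
    constructor
    · refine IntegrableOn.congr_fun ?_ (fun x hx => (key x hx).symm) measurableSet_Ioi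
      rw [IntegrableOn, integrable_indicator_iff measurableSet_Ioi]
      exact (integrableOn_Ioi_cpow_of_lt hre one_pos).restrict
    · rw [mellin, setIntegral_congr_fun measurableSet_Ioi key, setIntegral_indicator
        measurableSet_Ioi, Ioi_inter_Ioi, sup_of_le_right zero_le_one,
        integral_Ioi_cpow_of_lt hre one_pos, ofReal_one, one_cpow,
        show (s - 3 / 2 + 1) = -(1 / 2 - s) by ring, neg_div_neg_eq]
  have hAB := hasMellin_sub hA.1 hB.1
  have hABC := hasMellin_sub hAB.1 hC.1
  have hH := hasMellin_const_smul hABC.1 (1 / 2 : ℂ)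
  have hval : (1 / 2 : ℂ) • (mellin (fun t => P.f_modif t -
      indicator (Ioc 0 1) (fun _ => 1 : ℝ → ℂ) t -
      indicator (Ioi (1 : ℝ)) (fun t : ℝ => (t : ℂ) ^ (-(1 / 2) : ℂ)) t) s) =
      completedRiemannZeta (2 * s) := by
    rw [hABC.2, hAB.2, hA.2, hB.2, hC.2, completedRiemannZeta, completedHurwitzZetaEven,
      WeakFEPair.Λ]
    simp [P, hurwitzEvenFEPair]
    ring
  have hae : ∀ᵐ x : ℝ ∂(volume.restrict (Ioi (0 : ℝ))), (x : ℂ) ^ (s - 1) • ((1 / 2 : ℂ) •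
      (P.f_modif x - indicator (Ioc 0 1) (fun _ => 1 : ℝ → ℂ) x -
      indicator (Ioi (1 : ℝ)) (fun t : ℝ => (t : ℂ) ^ (-(1 / 2) : ℂ)) x)) =
      (x : ℂ) ^ (s - 1) • (reducedTheta x : ℂ) := by
    rw [ae_restrict_iff' measurableSet_Ioi]
    have : ∀ᵐ x : ℝ, x ≠ 1 := by simp [ae_iff]
    filter_upwards [this] with x hx1 hx0
    have hx0' : (0 : ℝ) < x := hx0
    congr 1
    rcases lt_or_gt_of_ne hx1 with h | h
    · have m1 : x ∈ Ioo (0 : ℝ) 1 := ⟨hx0, h⟩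
      have m2 : x ∈ Ioc (0 : ℝ) 1 := ⟨hx0, h.le⟩
      have m3 : x ∉ Ioi (1 : ℝ) := not_lt.mpr h.le
      simp only [WeakFEPair.f_modif, Pi.add_apply, indicator_of_mem m1, indicator_of_mem m2,
        indicator_of_notMem m3, P, hurwitzEvenFEPair, reducedTheta, halfTheta]
      simp
      ring
    · have m1 : x ∉ Ioo (0 : ℝ) 1 := fun h' => absurd h'.2 (not_lt.mpr h.le)
      have m2 : x ∉ Ioc (0 : ℝ) 1 := fun h' => absurd h'.2 (not_le.mpr h)
      have m3 : x ∈ Ioi (1 : ℝ) := h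
      simp only [WeakFEPair.f_modif, Pi.add_apply, indicator_of_notMem m1, indicator_of_notMem m2,
        indicator_of_mem m3, P, hurwitzEvenFEPair, reducedTheta, halfTheta]
      have : ((x ^ (-(1 / 2) : ℝ) : ℝ) : ℂ) = (x : ℂ) ^ (-(1 / 2) : ℂ) := by
        rw [ofReal_cpow hx0'.le]; norm_num
      simp only [ofReal_sub, ofReal_div, this]
      simp
      ring
  refine ⟨Integrable.congr hH.1 hae, ?_⟩
  rw [mellin, ← integral_congr_ae hae]
  exact hH.2.trans hval

/-! ### Mellin transforms in logarithmic coordinates -/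

lemma image_exp_univ : rexp '' univ = Ioi 0 := by rw [image_univ, Real.range_exp]

lemma exp_smul_cpow_sub_one (x : ℝ) (s w : ℂ) :
    |rexp x| • ((rexp x : ℂ) ^ (s - 1) • w) = cexp (s * x) * w := by
  rw [abs_of_pos (Real.exp_pos x), Complex.real_smul, smul_eq_mul, ← mul_assoc]
  congr 1
  rw [cpow_def_of_ne_zero (by exact_mod_cast (Real.exp_pos x).ne'),
    ← ofReal_log (Real.exp_pos x).le, Real.log_exp, ofReal_exp, ← Complex.exp_add]
  ring_nf

/-- Mellin convergence in logarithmic coordinates. -/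
lemma mellinConvergent_iff_integrable_exp (f : ℝ → ℂ) (s : ℂ) :
    MellinConvergent f s ↔ Integrable (fun x : ℝ => cexp (s * x) * f (rexp x)) := by
  rw [MellinConvergent, ← image_exp_univ, integrableOn_image_iff_integrableOn_abs_deriv_smul
    MeasurableSet.univ (fun x _ => (Real.hasDerivAt_exp x).hasDerivWithinAt)
    Real.exp_injective.injOn, integrableOn_univ]
  simp only [exp_smul_cpow_sub_one]

/-- The Mellin transform in logarithmic coordinates. -/
lemma mellin_eq_integral_exp (f : ℝ → ℂ) (s : ℂ) :
    mellin f s = ∫ x : ℝ, cexp (s * x) * f (rexp x) := by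
  rw [mellin, ← image_exp_univ, integral_image_eq_integral_abs_deriv_smul
    MeasurableSet.univ (fun x _ => (Real.hasDerivAt_exp x).hasDerivWithinAt)
    Real.exp_injective.injOn, setIntegral_univ]
  simp only [exp_smul_cpow_sub_one]

/-! ### Termwise differentiation of `𝒥_τ` -/

/-- The general term of the `k`-th derivative of `calJ τ`. -/
noncomputable def calJDerivTerm (τ : ℝ) (k : ℕ) (p : ℕ+ × ℕ+) (y : ℝ) : ℝ :=
  ((p.2 : ℝ) / (p.1 : ℝ)) ^ τ * (-2 * π * p.1 * p.2) ^ k * rexp (-2 * π * p.1 * p.2 * y)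

/-- The `k`-th derivative of `calJ τ` on `(0, ∞)`, as a double series. -/
noncomputable def calJDeriv (τ : ℝ) (k : ℕ) (y : ℝ) : ℝ := ∑' p, calJDerivTerm τ k p y

/-- A summable majorant of `calJDerivTerm` on `[δ, ∞)`. -/
noncomputable def calJDerivBound (τ : ℝ) (k : ℕ) (δ : ℝ) (p : ℕ+ × ℕ+) : ℝ :=
  ((p.2 : ℝ) / (p.1 : ℝ)) ^ τ * (2 * π * p.1 * p.2) ^ k * rexp (-(π * p.1 * p.2 * δ))

lemma one_le_pnat_cast (n : ℕ+) : (1 : ℝ) ≤ n := by exact_mod_cast _root_.one_le (a := n)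

lemma calJDerivBound_nonneg (τ : ℝ) (k : ℕ) (δ : ℝ) (p : ℕ+ × ℕ+) :
    0 ≤ calJDerivBound τ k δ p := by
  unfold calJDerivBound; positivity

lemma summable_calJDerivBound {τ : ℝ} (h0 : 0 ≤ τ) (h1 : τ ≤ 1) (k : ℕ) {δ : ℝ} (hδ : 0 < δ) :
    Summable (calJDerivBound τ k δ) := by
  set c := π * δ / 2 with hc
  have hc0 : 0 < c := by positivity
  have s1 (j : ℕ) : Summable fun n : ℕ+ => (n : ℝ) ^ j * rexp (-c * n) :=
    (Real.summable_pow_mul_exp_neg_nat_mul j hc0).comp_injective PNat.coe_injective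
  -- The extra power of `n` absorbs `(n/m)^τ ≤ n`.
  have s2 := ((s1 k).mul_of_nonneg (s1 (k + 1)) (fun _ => by positivity)
    (fun _ => by positivity)).mul_left ((2 * π) ^ k)
  refine Summable.of_nonneg_of_le (calJDerivBound_nonneg τ k δ) (fun p => ?_) s2
  have hm := one_le_pnat_cast p.1
  have hn := one_le_pnat_cast p.2
  have e1 : ((p.2 : ℝ) / (p.1 : ℝ)) ^ τ ≤ p.2 :=
    calc ((p.2 : ℝ) / (p.1 : ℝ)) ^ τ ≤ (p.2 : ℝ) ^ τ :=
          Real.rpow_le_rpow (by positivity) (div_le_self (by positivity) hm) h0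
      _ ≤ (p.2 : ℝ) ^ (1 : ℝ) := Real.rpow_le_rpow_of_exponent_le hn h1
      _ = p.2 := Real.rpow_one _
  have e2 : rexp (-(π * p.1 * p.2 * δ)) ≤ rexp (-c * p.1) * rexp (-c * p.2) := by
    rw [← Real.exp_add]
    apply Real.exp_le_exp.mpr
    have : (p.1 : ℝ) + p.2 ≤ 2 * (p.1 * p.2) := by nlinarith
    have := mul_le_mul_of_nonneg_left this hc0.le
    have e : π * p.1 * p.2 * δ = c * (2 * (p.1 * p.2)) := by rw [hc]; ring
    rw [e]; linarith
  calc calJDerivBound τ k δ p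
      ≤ p.2 * (2 * π * p.1 * p.2) ^ k * (rexp (-c * p.1) * rexp (-c * p.2)) := by
        unfold calJDerivBound; gcongr
    _ = _ := by simp only [mul_pow, pow_succ]; ring

/-- The exponent is split by `2mny ≥ mnδ + y`: one part makes the series summable, the other keeps
exponential decay in `y`. -/
lemma norm_calJDerivTerm_le (τ : ℝ) (k : ℕ) {δ : ℝ} (p : ℕ+ × ℕ+) {y : ℝ} (hδ : 0 < δ)
    (hy : δ ≤ y) : ‖calJDerivTerm τ k p y‖ ≤ calJDerivBound τ k δ p * rexp (-(π * y)) := by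
  have hm := one_le_pnat_cast p.1
  have hn := one_le_pnat_cast p.2
  have e0 : |(-2 * π * p.1 * p.2 : ℝ)| = 2 * π * p.1 * p.2 := by
    rw [show (-2 * π * p.1 * p.2 : ℝ) = -(2 * π * p.1 * p.2) by ring, abs_neg,
      abs_of_nonneg (by positivity)]
  rw [calJDerivTerm, calJDerivBound, norm_mul, norm_mul, norm_pow, Real.norm_eq_abs (_ * _ * _), e0,
    Real.norm_of_nonneg (by positivity), Real.norm_of_nonneg (Real.exp_pos _).le,
    mul_assoc (_ * _) (rexp _), ← Real.exp_add]
  gcongr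
  have h1 : (1 : ℝ) ≤ p.1 * p.2 := by nlinarith
  have h2 : (p.1 * p.2 : ℝ) * δ + y ≤ 2 * (p.1 * p.2) * y := by nlinarith
  nlinarith [mul_le_mul_of_nonneg_left h2 Real.pi_pos.le]

lemma norm_calJDerivTerm_le_bound (τ : ℝ) (k : ℕ) {δ : ℝ} (p : ℕ+ × ℕ+) {y : ℝ} (hδ : 0 < δ)
    (hy : δ ≤ y) : ‖calJDerivTerm τ k p y‖ ≤ calJDerivBound τ k δ p :=
  (norm_calJDerivTerm_le τ k p hδ hy).trans <|
    mul_le_of_le_one_right (calJDerivBound_nonneg τ k δ p)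
      (Real.exp_le_one_iff.mpr (by nlinarith [Real.pi_pos]))

section
variable {τ : ℝ} (h0 : 0 ≤ τ) (h1 : τ ≤ 1)
include h0 h1

lemma summable_calJDerivTerm (k : ℕ) {y : ℝ} (hy : 0 < y) :
    Summable fun p => calJDerivTerm τ k p y :=
  .of_norm_bounded (summable_calJDerivBound h0 h1 k hy)
    fun p => norm_calJDerivTerm_le_bound τ k p hy le_rfl

lemma exists_norm_calJDeriv_le (k : ℕ) {δ : ℝ} (hδ : 0 < δ) :
    ∃ C, 0 ≤ C ∧ ∀ y, δ ≤ y → ‖calJDeriv τ k y‖ ≤ C * rexp (-(π * y)) := by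
  refine ⟨∑' p, calJDerivBound τ k δ p, tsum_nonneg (calJDerivBound_nonneg τ k δ),
    fun y hy => ?_⟩
  rw [calJDeriv, ← tsum_mul_right]
  exact tsum_of_norm_bounded ((summable_calJDerivBound h0 h1 k hδ).mul_right _).hasSum
    fun p => norm_calJDerivTerm_le τ k p hδ hy

lemma hasDerivAt_calJDeriv (k : ℕ) {y : ℝ} (hy : 0 < y) :
    HasDerivAt (calJDeriv τ k) (calJDeriv τ (k + 1) y) y := by
  refine hasDerivAt_tsum_of_isPreconnected (t := Ioi (y / 2)) (y₀ := y)
    (summable_calJDerivBound h0 h1 (k + 1) (half_pos hy))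
    isOpen_Ioi isPreconnected_Ioi (fun p z _ => ?_) (fun p z hz => ?_) (half_lt_self hy)
    (summable_calJDerivTerm h0 h1 k hy) (half_lt_self hy)
  · have := (((hasDerivAt_id z).const_mul (-2 * π * p.1 * p.2)).exp).const_mul
      (((p.2 : ℝ) / (p.1 : ℝ)) ^ τ * (-2 * π * p.1 * p.2) ^ k)
    refine this.congr_deriv ?_
    simp only [calJDerivTerm, id, pow_succ]; ring
  · exact norm_calJDerivTerm_le_bound τ (k + 1) p (half_pos hy) (le_of_lt hz)

lemma continuousOn_calJDeriv (k : ℕ) : ContinuousOn (calJDeriv τ k) (Ioi 0) :=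
  fun _ hy => (hasDerivAt_calJDeriv h0 h1 k hy).continuousAt.continuousWithinAt

lemma calJ_eq_calJDeriv {y : ℝ} (hy : 0 < y) : calJ τ y = calJDeriv τ 0 y := by
  have h := summable_calJDerivTerm h0 h1 0 hy
  rw [calJDeriv, h.tsum_prod]
  simp [calJ, calJDerivTerm]

lemma iteratedDeriv_calJ_eqOn (k : ℕ) :
    EqOn (iteratedDeriv k (calJ τ)) (calJDeriv τ k) (Ioi 0) := by
  induction k with
  | zero => intro y hy; simpa using calJ_eq_calJDeriv h0 h1 hy
  | succ k ih =>
    intro y hy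
    rw [iteratedDeriv_succ, (ih.eventuallyEq_of_mem (Ioi_mem_nhds hy)).deriv_eq]
    exact (hasDerivAt_calJDeriv h0 h1 k hy).deriv

lemma contDiffOn_calJDeriv (n k : ℕ) : ContDiffOn ℝ n (calJDeriv τ k) (Ioi 0) := by
  induction n generalizing k with
  | zero => simpa using continuousOn_calJDeriv h0 h1 k
  | succ n ih =>
    rw [Nat.cast_succ, contDiffOn_succ_iff_deriv_of_isOpen isOpen_Ioi]
    refine ⟨fun y hy => (hasDerivAt_calJDeriv h0 h1 k hy).differentiableAt.differentiableWithinAt,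
      by simp, (ih (k + 1)).congr fun y hy => (hasDerivAt_calJDeriv h0 h1 k hy).deriv⟩

lemma contDiffOn_calJ (n : ℕ) : ContDiffOn ℝ n (calJ τ) (Ioi 0) :=
  (contDiffOn_calJDeriv h0 h1 n 0).congr fun _ hy => calJ_eq_calJDeriv h0 h1 hy

end

/-! ### The substitution `y = cosh d` -/

lemma one_add_sq_div_four_le_cosh (d : ℝ) : 1 + d ^ 2 / 4 ≤ Real.cosh d := by
  have h1 := Real.quadratic_le_exp_of_nonneg (abs_nonneg d)
  have h2 := Real.add_one_le_exp (-|d|)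
  rw [← Real.cosh_abs, Real.cosh_eq]
  rw [sq_abs] at h1
  linarith

/-- Substitution `y = cosh d` in integrals against `etaWeight`. -/
lemma integral_mul_etaWeight {τ : ℝ} {H : ℝ → ℝ}
    (hH : Integrable fun d => H (Real.cosh d) * rexp (τ * d)) :
    IntegrableOn (fun y => H y * etaWeight τ y) (Ioi 1) ∧
    ∫ y in Ioi 1, H y * etaWeight τ y = ∫ d, H (Real.cosh d) * rexp (τ * d) := by
  have himg : Real.cosh '' Ioi 0 = Ioi 1 := by
    ext y
    constructor
    · rintro ⟨x, hx, rfl⟩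
      exact Real.one_lt_cosh.mpr (ne_of_gt hx)
    · intro hy
      have hy' : (1 : ℝ) < y := hy
      exact ⟨Real.arcosh y, Real.arcosh_pos hy', Real.cosh_arcosh hy'.le⟩
  have hinj : InjOn Real.cosh (Ioi 0) := Real.cosh_strictMonoOn.injOn.mono Ioi_subset_Ici_self
  have hd : ∀ x ∈ Ioi (0 : ℝ), HasDerivWithinAt Real.cosh (Real.sinh x) (Ioi 0) x :=
    fun x _ => (Real.hasDerivAt_cosh x).hasDerivWithinAt
  -- The Jacobian `sinh` cancels the square root in the weight, and `y + √(y²-1) = exp d`; the two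
  -- powers become `exp(±τd)`, which unfold the half line to the whole line.
  have hint : ∀ x ∈ Ioi (0 : ℝ), |Real.sinh x| • (H (Real.cosh x) * etaWeight τ (Real.cosh x)) =
      H (Real.cosh x) * rexp (τ * x) + H (Real.cosh (-x)) * rexp (τ * (-x)) := by
    intro x hx
    have hs : 0 < Real.sinh x := Real.sinh_pos_iff.mpr hx
    have e1 : √(Real.cosh x ^ 2 - 1) = Real.sinh x := by
      rw [Real.cosh_sq, add_sub_cancel_right, Real.sqrt_sq hs.le]
    rw [etaWeight, e1, Real.cosh_add_sinh, abs_of_pos hs, ← Real.exp_mul, ← Real.exp_mul,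
      Real.cosh_neg, smul_eq_mul, mul_comm x τ, mul_comm x (-τ), neg_mul, mul_neg]
    field_simp
  have hneg : Integrable fun d => H (Real.cosh (-d)) * rexp (τ * (-d)) := hH.comp_neg
  constructor
  · rw [← himg, integrableOn_image_iff_integrableOn_abs_deriv_smul measurableSet_Ioi hd hinj]
    exact (hH.integrableOn.add hneg.integrableOn).congr_fun
      (fun x hx => (hint x hx).symm) measurableSet_Ioi
  · rw [← himg, integral_image_eq_integral_abs_deriv_smul measurableSet_Ioi hd hinj,
      setIntegral_congr_fun measurableSet_Ioi hint, integral_add hH.integrableOn hneg.integrableOn,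
      integral_comp_neg_Ioi (f := fun d => H (Real.cosh d) * rexp (τ * d)), neg_zero, add_comm]
    exact intervalIntegral.integral_Iic_add_Ioi hH.integrableOn hH.integrableOn

lemma integrable_cosh_pow_mul_exp (k : ℕ) {c : ℝ} (hc : 0 < c) (τ : ℝ) :
    Integrable fun d => Real.cosh d ^ k * rexp (-(c * Real.cosh d)) * rexp (τ * d) := by
  -- Half of `c cosh d` absorbs `cosh^k`; the other half is at least `c d²/8`, and completing the
  -- square against `τd` costs `4τ²/c` and leaves `c d²/16`.
  set C := (k.factorial : ℝ) / (c / 2) ^ k * rexp (4 * τ ^ 2 / c)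
  refine ((integrable_exp_neg_mul_sq (b := c / 16) (by positivity)).const_mul C).mono'
    (by fun_prop) (ae_of_all _ fun d => ?_)
  have hd := Real.cosh_pos d
  rw [Real.norm_of_nonneg (by positivity)]
  have h1 : Real.cosh d ^ k ≤ k.factorial / (c / 2) ^ k * rexp (c / 2 * Real.cosh d) := by
    have := Real.pow_div_factorial_le_exp (x := c / 2 * Real.cosh d) (by positivity) k
    rw [div_le_iff₀ (by positivity), mul_pow] at this
    rw [div_mul_eq_mul_div, le_div_iff₀ (by positivity)]
    linarith
  calc _ ≤ (k.factorial / (c / 2) ^ k * rexp (c / 2 * Real.cosh d)) *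
        rexp (-(c * Real.cosh d)) * rexp (τ * d) := by gcongr
    _ = k.factorial / (c / 2) ^ k * rexp (-(c / 2 * Real.cosh d) + τ * d) := by
        rw [mul_assoc, mul_assoc, ← Real.exp_add, ← Real.exp_add]; ring_nf
    _ ≤ k.factorial / (c / 2) ^ k * rexp (4 * τ ^ 2 / c + -(c / 16) * d ^ 2) := by
        refine mul_le_mul_of_nonneg_left (Real.exp_le_exp.mpr ?_) (by positivity)
        have h2 := mul_le_mul_of_nonneg_left (one_add_sq_div_four_le_cosh d) (half_pos hc).le
        have h3 : 0 ≤ (τ - c / 8 * d) ^ 2 * (4 / c) := by positivity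
        have h4 : (τ - c / 8 * d) ^ 2 * (4 / c) = 4 * τ ^ 2 / c - τ * d + c / 16 * d ^ 2 := by
          field_simp; ring
        linarith
    _ = _ := by rw [Real.exp_add]; ring

/-- The integral `∫_ℝ (cosh d)^k 𝒥_τ^(k)(q cosh d) e^(τ d) dd`. -/
noncomputable def coshIntegral (τ : ℝ) (k : ℕ) (q : ℝ) : ℝ :=
  ∫ d, Real.cosh d ^ k * calJDeriv τ k (q * Real.cosh d) * rexp (τ * d)

section
variable {τ : ℝ} (h0 : 0 ≤ τ) (h1 : τ ≤ 1)
include h0 h1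

lemma continuous_coshIntegrand (j k : ℕ) {q : ℝ} (hq : 0 < q) : Continuous fun d : ℝ =>
    Real.cosh d ^ j * calJDeriv τ k (q * Real.cosh d) * rexp (τ * d) := by
  have : Continuous fun d => calJDeriv τ k (q * Real.cosh d) :=
    (continuousOn_calJDeriv h0 h1 k).comp_continuous (by fun_prop)
      fun d => mul_pos hq (Real.cosh_pos d)
  fun_prop

lemma exists_coshIntegrand_bound (j k : ℕ) {δ : ℝ} (hδ : 0 < δ) : ∃ bound : ℝ → ℝ,
    Integrable bound ∧ ∀ q, δ ≤ q → ∀ d : ℝ,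
      ‖Real.cosh d ^ j * calJDeriv τ k (q * Real.cosh d) * rexp (τ * d)‖ ≤ bound d := by
  obtain ⟨C, hC, hb⟩ := exists_norm_calJDeriv_le h0 h1 k hδ
  refine ⟨_, (integrable_cosh_pow_mul_exp j (mul_pos Real.pi_pos hδ) τ).const_mul C,
    fun q hq d => ?_⟩
  have hd := Real.one_le_cosh d
  have hd0 := Real.cosh_pos d
  rw [norm_mul, norm_mul, Real.norm_of_nonneg (by positivity : 0 ≤ Real.cosh d ^ j),
    Real.norm_of_nonneg (Real.exp_pos _).le]
  have hle : δ * Real.cosh d ≤ q * Real.cosh d := by gcongr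
  calc _ ≤ Real.cosh d ^ j * (C * rexp (-(π * (q * Real.cosh d)))) * rexp (τ * d) := by
        gcongr; exact hb _ (by nlinarith)
    _ ≤ Real.cosh d ^ j * (C * rexp (-(π * (δ * Real.cosh d)))) * rexp (τ * d) := by
        gcongr
    _ = _ := by rw [← mul_assoc π]; ring

lemma integrable_coshIntegrand (j k : ℕ) {q : ℝ} (hq : 0 < q) : Integrable fun d : ℝ =>
    Real.cosh d ^ j * calJDeriv τ k (q * Real.cosh d) * rexp (τ * d) := by
  obtain ⟨b, hb, hle⟩ := exists_coshIntegrand_bound h0 h1 j k hq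
  exact hb.mono' (continuous_coshIntegrand h0 h1 j k hq).aestronglyMeasurable
    (ae_of_all _ (hle q le_rfl))

lemma hasDerivAt_coshIntegral (k : ℕ) {q : ℝ} (hq : 0 < q) :
    HasDerivAt (coshIntegral τ k) (coshIntegral τ (k + 1) q) q := by
  obtain ⟨b, hb, hle⟩ := exists_coshIntegrand_bound h0 h1 (k + 1) (k + 1) (half_pos hq)
  refine (hasDerivAt_integral_of_dominated_loc_of_deriv_le (Ioi_mem_nhds (half_lt_self hq))
    ?_ (integrable_coshIntegrand h0 h1 k k hq)
    (continuous_coshIntegrand h0 h1 (k + 1) (k + 1) hq).aestronglyMeasurable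
    (ae_of_all _ fun d x hx => hle x (le_of_lt hx) d) hb (ae_of_all _ fun d x hx => ?_)).2
  · filter_upwards [Ioi_mem_nhds hq] with x hx
    exact (continuous_coshIntegrand h0 h1 k k hx).aestronglyMeasurable
  · have hx0 : 0 < x := (half_pos hq).trans hx
    have h := (hasDerivAt_calJDeriv h0 h1 k (mul_pos hx0 (Real.cosh_pos d))).comp x
      ((hasDerivAt_id x).mul_const (Real.cosh d))
    refine ((h.const_mul (Real.cosh d ^ k)).mul_const (rexp (τ * d))).congr_deriv ?_
    ring

end

/-! ### Theta products and the integral of `𝒥_τ` -/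

lemma continuous_halfTheta_exp : Continuous fun x => halfTheta (rexp x) :=
  continuousOn_halfTheta.comp_continuous Real.continuous_exp Real.exp_pos

lemma halfTheta_nonneg {u : ℝ} (hu : 0 < u) : 0 ≤ halfTheta u :=
  (hasSum_halfTheta hu).nonneg fun _ => (Real.exp_pos _).le

lemma exists_halfTheta_le : ∃ K, 0 ≤ K ∧ ∀ u, 0 < u → halfTheta u ≤ K * u⁻¹ := by
  have hs : Summable fun n : ℕ+ => ((n : ℝ) ^ 2)⁻¹ :=
    (Real.summable_nat_pow_inv.mpr one_lt_two).comp_injective PNat.coe_injective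
  refine ⟨∑' n : ℕ+, ((n : ℝ) ^ 2)⁻¹, tsum_nonneg fun _ => by positivity, fun u hu => ?_⟩
  rw [← tsum_mul_right, ← (hasSum_halfTheta hu).tsum_eq]
  refine (hasSum_halfTheta hu).summable.tsum_le_tsum (fun n => ?_) (hs.mul_right _)
  have hn : (0 : ℝ) < (n : ℝ) ^ 2 * u := mul_pos (by have := one_le_pnat_cast n; positivity) hu
  rw [show -π * (n : ℝ) ^ 2 * u = -(π * ((n : ℝ) ^ 2 * u)) by ring, Real.exp_neg, ← mul_inv]
  apply inv_anti₀ hn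
  have h1 := Real.add_one_le_exp (π * ((n : ℝ) ^ 2 * u))
  nlinarith [Real.pi_gt_three]

lemma integrable_exp_mul_of_mellinConvergent {f : ℝ → ℝ} {σ : ℝ}
    (h : MellinConvergent (fun u => (f u : ℂ)) σ) :
    Integrable fun x => rexp (σ * x) * f (rexp x) := by
  refine ((mellinConvergent_iff_integrable_exp _ _).mp h).re.congr (ae_of_all _ fun x => ?_)
  simp only [← ofReal_mul, ← ofReal_exp, RCLike.re_to_complex, ofReal_re]

lemma integrable_exp_mul_halfTheta {σ : ℝ} (h : 1 / 2 < σ) :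
    Integrable fun x => rexp (σ * x) * halfTheta (rexp x) :=
  integrable_exp_mul_of_mellinConvergent (mellinConvergent_halfTheta (by simpa using h))

lemma integrable_exp_mul_reducedTheta {σ : ℝ} (h0 : 0 < σ) (h1 : σ < 1 / 2) :
    Integrable fun x => rexp (σ * x) * reducedTheta (rexp x) :=
  integrable_exp_mul_of_mellinConvergent
    (hasMellin_reducedTheta (by simpa using h0) (by simpa using h1)).1

/-- Bounding the second factor by `K exp(d-ρ)` leaves a single theta factor with weight
`exp((1+τ)d)`, inside its range of Mellin convergence. -/
lemma integrable_halfTheta_mul_halfTheta {τ : ℝ} (h0 : 0 < τ) (ρ : ℝ) :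
    Integrable fun d => halfTheta (rexp (ρ + d)) * halfTheta (rexp (ρ - d)) * rexp (τ * d) := by
  obtain ⟨K, hK, hb⟩ := exists_halfTheta_le
  have h := ((integrable_exp_mul_halfTheta (σ := 1 + τ) (by linarith)).comp_add_left ρ).const_mul
    (K * rexp (-(2 + τ) * ρ))
  have c1 : Continuous fun d => halfTheta (rexp (ρ + d)) :=
    continuous_halfTheta_exp.comp (continuous_const.add continuous_id)
  have c2 : Continuous fun d => halfTheta (rexp (ρ - d)) :=
    continuous_halfTheta_exp.comp (continuous_const.sub continuous_id)
  refine h.mono' (by fun_prop) (ae_of_all _ fun d => ?_)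
  have p1 := halfTheta_nonneg (Real.exp_pos (ρ + d))
  have p2 := halfTheta_nonneg (Real.exp_pos (ρ - d))
  rw [Real.norm_of_nonneg (by positivity)]
  calc _ ≤ halfTheta (rexp (ρ + d)) * (K * (rexp (ρ - d))⁻¹) * rexp (τ * d) := by
        gcongr; exact hb _ (Real.exp_pos _)
    _ = K * halfTheta (rexp (ρ + d)) * (rexp (-(ρ - d)) * rexp (τ * d)) := by
        rw [Real.exp_neg]; ring
    _ = K * halfTheta (rexp (ρ + d)) * (rexp (-(2 + τ) * ρ) * rexp ((1 + τ) * (ρ + d))) := by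
        rw [← Real.exp_add, ← Real.exp_add]; ring_nf
    _ = _ := by ring

/-- The shift by `log(m/n)` turns `2mn cosh` into `m² exp d + n² exp(-d)`, separating `m` from `n`,
while `exp(τ·)` absorbs the factor `(n/m)^τ`. -/
lemma calJDerivTerm_zero_shift (τ ρ d : ℝ) (p : ℕ+ × ℕ+) :
    calJDerivTerm τ 0 p (rexp ρ * Real.cosh (d + Real.log (p.1 / p.2))) *
      rexp (τ * (d + Real.log (p.1 / p.2))) =
    rexp (-π * (p.1 : ℝ) ^ 2 * rexp (ρ + d)) * rexp (-π * (p.2 : ℝ) ^ 2 * rexp (ρ - d)) *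
      rexp (τ * d) := by
  have hm : (0 : ℝ) < p.1 := by have := one_le_pnat_cast p.1; linarith
  have hn : (0 : ℝ) < p.2 := by have := one_le_pnat_cast p.2; linarith
  have e1 : ((p.2 : ℝ) / p.1) ^ τ * rexp (τ * (d + Real.log (p.1 / p.2))) = rexp (τ * d) := by
    rw [Real.rpow_def_of_pos (by positivity), ← Real.exp_add, ← inv_div, Real.log_inv]
    ring_nf
  have e2 : 2 * (p.1 : ℝ) * p.2 * Real.cosh (d + Real.log (p.1 / p.2)) =
      (p.1 : ℝ) ^ 2 * rexp d + (p.2 : ℝ) ^ 2 * rexp (-d) := by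
    rw [Real.cosh_eq, neg_add, Real.exp_add, Real.exp_add, Real.exp_neg (Real.log _),
      Real.exp_log (by positivity)]
    field_simp
  have e3 : rexp (-2 * π * p.1 * p.2 * (rexp ρ * Real.cosh (d + Real.log (p.1 / p.2)))) =
      rexp (-π * (p.1 : ℝ) ^ 2 * rexp (ρ + d)) * rexp (-π * (p.2 : ℝ) ^ 2 * rexp (ρ - d)) := by
    rw [← Real.exp_add (-π * _ * _), sub_eq_add_neg, Real.exp_add ρ, Real.exp_add ρ]
    congr 1
    linear_combination -π * rexp ρ * e2
  rw [calJDerivTerm, pow_zero, mul_one, mul_right_comm, e1, e3, mul_comm]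

lemma norm_calJDerivTerm_cosh_le (τ : ℝ) {q : ℝ} (hq : 0 < q) (p : ℕ+ × ℕ+) (d : ℝ) :
    ‖calJDerivTerm τ 0 p (q * Real.cosh d) * rexp (τ * d)‖ ≤
      calJDerivBound τ 0 q p * (Real.cosh d ^ 0 * rexp (-(π * q * Real.cosh d)) * rexp (τ * d)) := by
  have h := norm_calJDerivTerm_le τ 0 p hq
    (le_mul_of_one_le_right hq.le (Real.one_le_cosh d))
  rw [norm_mul, Real.norm_of_nonneg (Real.exp_pos _).le, pow_zero, one_mul, mul_assoc π,
    ← mul_assoc]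
  gcongr

/-- The integral of `calJ` against `etaWeight` is an integral of a product of theta functions. -/
lemma coshIntegral_zero_eq {τ : ℝ} (h0 : 0 ≤ τ) (h1 : τ ≤ 1) (ρ : ℝ) :
    coshIntegral τ 0 (rexp ρ) =
      ∫ d, halfTheta (rexp (ρ + d)) * halfTheta (rexp (ρ - d)) * rexp (τ * d) := by
  have hq := Real.exp_pos ρ
  set T : ℕ+ × ℕ+ → ℝ → ℝ := fun p d =>
    calJDerivTerm τ 0 p (rexp ρ * Real.cosh d) * rexp (τ * d) with hT
  set S : ℕ+ × ℕ+ → ℝ → ℝ := fun p d =>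
    rexp (-π * (p.1 : ℝ) ^ 2 * rexp (ρ + d)) * rexp (-π * (p.2 : ℝ) ^ 2 * rexp (ρ - d)) *
      rexp (τ * d) with hS
  have hTS (p) : (fun d => T p (d + Real.log (p.1 / p.2))) = S p :=
    funext fun d => calJDerivTerm_zero_shift τ ρ d p
  have hI := integrable_cosh_pow_mul_exp 0 (mul_pos Real.pi_pos hq) τ
  have hTint (p) : Integrable (T p) := by
    refine (hI.const_mul (calJDerivBound τ 0 (rexp ρ) p)).mono' ?_
      (ae_of_all _ (norm_calJDerivTerm_cosh_le τ hq p))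
    have : Continuous (T p) := by simp only [hT, calJDerivTerm]; fun_prop
    exact this.aestronglyMeasurable
  have hTsum : Summable fun p => ∫ d, ‖T p d‖ := by
    refine .of_nonneg_of_le (fun p => by positivity) (fun p => ?_)
      ((summable_calJDerivBound h0 h1 0 hq).mul_right
        (∫ d, Real.cosh d ^ 0 * rexp (-(π * rexp ρ * Real.cosh d)) * rexp (τ * d)))
    rw [← integral_const_mul]
    exact integral_mono (hTint p).norm (hI.const_mul _) (norm_calJDerivTerm_cosh_le τ hq p)
  have hSint (p) : Integrable (S p) := hTS p ▸ (hTint p).comp_add_right _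
  -- Each term has its own shift, so the two series agree only after integration; translation
  -- invariance carries the norm bounds over.
  have hSsum : Summable fun p => ∫ d, ‖S p d‖ := by
    refine hTsum.congr fun p => ?_
    rw [← hTS p]
    exact (integral_add_right_eq_self (fun d => ‖T p d‖) _).symm
  have e (p) : ∫ d, S p d = ∫ d, T p d := by
    rw [← hTS p]; exact integral_add_right_eq_self (T p) _
  have HT := hasSum_integral_of_summable_integral_norm hTint hTsum
  have HS := hasSum_integral_of_summable_integral_norm hSint hSsum
  simp only [e] at HS
  have HTS := HT.unique HS
  calc coshIntegral τ 0 (rexp ρ) = ∫ d, ∑' p, T p d := by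
        simp only [coshIntegral, pow_zero, one_mul, hT, tsum_mul_right, calJDeriv]
    _ = ∫ d, ∑' p, S p d := HTS
    _ = _ := by
        congr 1 with d
        have s1 := hasSum_halfTheta (Real.exp_pos (ρ + d))
        have s2 := hasSum_halfTheta (Real.exp_pos (ρ - d))
        have s3 := s1.summable.mul_of_nonneg s2.summable (fun _ => (Real.exp_pos _).le)
          (fun _ => (Real.exp_pos _).le)
        simp only [hS, tsum_mul_right]
        rw [(s1.mul s2 s3).tsum_eq]

/-! ### The even kernel and `|Λ|²` -/

/-- The even kernel whose Fourier transform is `|Λ(1/2 + τ + it)|² / 2`. -/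
noncomputable def zetaKernel (τ ρ : ℝ) : ℝ :=
  rexp (ρ / 2) * ∫ d, reducedTheta (rexp (ρ + d)) * reducedTheta (rexp (ρ - d)) * rexp (τ * d)

lemma zetaKernel_neg (τ ρ : ℝ) : zetaKernel τ (-ρ) = zetaKernel τ ρ := by
  rw [zetaKernel, zetaKernel, ← integral_const_mul, ← integral_const_mul]
  congr 1 with d
  rw [show -ρ + d = -(ρ - d) by ring, show -ρ - d = -(ρ + d) by ring, reducedTheta_exp_neg,
    reducedTheta_exp_neg]
  have : rexp (-ρ / 2) * (rexp ((ρ - d) / 2) * rexp ((ρ + d) / 2)) = rexp (ρ / 2) := by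
    rw [← Real.exp_add, ← Real.exp_add]; ring_nf
  rw [← this]; ring

/-- `zetaKernel` differs from the integral of `calJ` by two decaying exponentials. -/
lemma zetaKernel_eq {τ : ℝ} (h0 : 0 < τ) (h1 : τ < 1 / 2) : ∃ α β : ℝ, ∀ ρ, zetaKernel τ ρ =
    rexp (ρ / 2) * coshIntegral τ 0 (rexp ρ) - α * rexp (-((1 / 2 + τ) * ρ))
      - β * rexp (-((1 / 2 - τ) * ρ)) := by
  have i1 := integrable_exp_mul_halfTheta (σ := 1 / 2 + τ) (by linarith)
  have i2 := integrable_exp_mul_reducedTheta (σ := 1 / 2 - τ) (by linarith) (by linarith)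
  refine ⟨(∫ x, rexp ((1 / 2 + τ) * x) * halfTheta (rexp x)) / 2,
    (∫ x, rexp ((1 / 2 - τ) * x) * reducedTheta (rexp x)) / 2, fun ρ => ?_⟩
  have j0 := integrable_halfTheta_mul_halfTheta h0 ρ
  have j1 := (i1.comp_add_left ρ).const_mul (rexp (-((1 + τ) * ρ)) / 2)
  have j2 := (i2.comp_sub_left ρ).const_mul (rexp (-((1 - τ) * ρ)) / 2)
  -- Only one factor is expanded at a time: the full expansion would contain a multiple of
  -- `exp(τd)`, which is not integrable.
  have e : ∀ d, reducedTheta (rexp (ρ + d)) * reducedTheta (rexp (ρ - d)) * rexp (τ * d) =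
      halfTheta (rexp (ρ + d)) * halfTheta (rexp (ρ - d)) * rexp (τ * d) -
      rexp (-((1 + τ) * ρ)) / 2 * (rexp ((1 / 2 + τ) * (ρ + d)) * halfTheta (rexp (ρ + d))) -
      rexp (-((1 - τ) * ρ)) / 2 * (rexp ((1 / 2 - τ) * (ρ - d)) * reducedTheta (rexp (ρ - d))) := by
    intro d
    have x1 : rexp (-((1 + τ) * ρ)) * rexp ((1 / 2 + τ) * (ρ + d)) =
        rexp ((ρ - d) * (-(1 / 2))) * rexp (τ * d) := by
      rw [← Real.exp_add, ← Real.exp_add]; ring_nf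
    have x2 : rexp (-((1 - τ) * ρ)) * rexp ((1 / 2 - τ) * (ρ - d)) =
        rexp ((ρ + d) * (-(1 / 2))) * rexp (τ * d) := by
      rw [← Real.exp_add, ← Real.exp_add]; ring_nf
    have y1 : reducedTheta (rexp (ρ - d)) =
        halfTheta (rexp (ρ - d)) - rexp ((ρ - d) * (-(1 / 2))) / 2 := by
      rw [reducedTheta, ← Real.exp_mul]
    have y2 : reducedTheta (rexp (ρ + d)) =
        halfTheta (rexp (ρ + d)) - rexp ((ρ + d) * (-(1 / 2))) / 2 := by
      rw [reducedTheta, ← Real.exp_mul]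
    linear_combination rexp (τ * d) * halfTheta (rexp (ρ + d)) * y1 +
      rexp (τ * d) * reducedTheta (rexp (ρ - d)) * y2 +
      halfTheta (rexp (ρ + d)) / 2 * x1 + reducedTheta (rexp (ρ - d)) / 2 * x2
  rw [zetaKernel, integral_congr_ae (ae_of_all _ e), integral_sub (by exact j0.sub j1) j2,
    integral_sub j0 j1, integral_const_mul, integral_const_mul,
    integral_add_left_eq_self (fun x => rexp ((1 / 2 + τ) * x) * halfTheta (rexp x)),
    integral_sub_left_eq_self (fun x => rexp ((1 / 2 - τ) * x) * reducedTheta (rexp x)),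
    coshIntegral_zero_eq h0.le (by linarith)]
  have z1 : rexp (-((1 / 2 + τ) * ρ)) = rexp (ρ / 2) * rexp (-((1 + τ) * ρ)) := by
    rw [← Real.exp_add]; ring_nf
  have z2 : rexp (-((1 / 2 - τ) * ρ)) = rexp (ρ / 2) * rexp (-((1 - τ) * ρ)) := by
    rw [← Real.exp_add]; ring_nf
  rw [z1, z2]; ring

/-- Reflection holds because `Λ(2z)` is here the Mellin transform of a real function. -/
lemma completedRiemannZeta_two_mul_conj {z : ℂ} (h0 : 0 < z.re) (h1 : z.re < 1 / 2) :
    completedRiemannZeta (2 * conj z) = conj (completedRiemannZeta (2 * z)) := by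
  rw [← (hasMellin_reducedTheta h0 h1).2,
    ← (hasMellin_reducedTheta (s := conj z) (by rwa [conj_re])
      (by rwa [conj_re])).2, mellin_eq_integral_exp,
    mellin_eq_integral_exp, ← integral_conj]
  simp [← Complex.exp_conj]

/-- Centring at `a = c/2 + d` makes the theta arguments symmetric, so `c/2` plays the role of `ρ`.
-/
lemma convolution_reducedTheta (τ t c : ℝ) :
    (∫ a : ℝ, (cexp ((1 / 2 + t * I + τ) / 2 * a) * reducedTheta (rexp a)) *
      (cexp ((1 / 2 + t * I - τ) / 2 * (c - a : ℝ)) * reducedTheta (rexp (c - a)))) =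
    cexp (t * I * (c / 2 : ℝ)) * zetaKernel τ (c / 2) := by
  rw [← integral_add_left_eq_self _ (c / 2), zetaKernel, ofReal_mul, ← integral_complex_ofReal,
    ← mul_assoc, ← integral_const_mul]
  congr 1 with d
  rw [show c - (c / 2 + d) = c / 2 - d by ring]
  have : cexp ((1 / 2 + t * I + τ) / 2 * (c / 2 + d : ℝ)) *
      cexp ((1 / 2 + t * I - τ) / 2 * (c / 2 - d : ℝ)) =
      cexp (t * I * (c / 2 : ℝ)) * rexp (c / 2 / 2) * rexp (τ * d) := by
    rw [ofReal_exp, ofReal_exp, ← Complex.exp_add, ← Complex.exp_add, ← Complex.exp_add]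
    push_cast; ring_nf
  push_cast at this ⊢
  linear_combination (reducedTheta (rexp (c / 2 + d)) : ℂ) * reducedTheta (rexp (c / 2 - d)) * this

lemma integral_exp_mul_zetaKernel {τ : ℝ} (h0 : 0 < τ) (h1 : τ < 1 / 2) (t : ℝ) :
    Integrable (fun ρ : ℝ => cexp (t * I * ρ) * zetaKernel τ ρ) ∧
    2 * ∫ ρ : ℝ, cexp (t * I * ρ) * zetaKernel τ ρ =
      normSq (completedRiemannZeta (1 / 2 + τ + t * I)) := by
  set z : ℂ := (1 / 2 + t * I + τ) / 2 with hz
  set w : ℂ := (1 / 2 + t * I - τ) / 2 with hw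
  have hzr : z.re = 1 / 4 + τ / 2 := by simp [hz]; ring
  have hwr : w.re = 1 / 4 - τ / 2 := by simp [hw]; ring
  have hz0 : 0 < z.re := by rw [hzr]; linarith
  have hz1 : z.re < 1 / 2 := by rw [hzr]; linarith
  have hw0 : 0 < w.re := by rw [hwr]; linarith
  have hw1 : w.re < 1 / 2 := by rw [hwr]; linarith
  have hA := (mellinConvergent_iff_integrable_exp _ _).mp (hasMellin_reducedTheta hz0 hz1).1
  have hB := (mellinConvergent_iff_integrable_exp _ _).mp (hasMellin_reducedTheta hw0 hw1).1
  have hc := hA.integrable_convolution (ContinuousLinearMap.mul ℝ ℂ) hB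
  have hi := integral_convolution (ContinuousLinearMap.mul ℝ ℂ) hA hB (μ := volume) (ν := volume)
  have hconv : (convolution (fun x : ℝ => cexp (z * x) * reducedTheta (rexp x))
      (fun x : ℝ => cexp (w * x) * reducedTheta (rexp x)) (ContinuousLinearMap.mul ℝ ℂ) volume) =
      fun c : ℝ => (fun ρ : ℝ => cexp (t * I * ρ) * zetaKernel τ ρ) (c / 2) := by
    ext c
    exact convolution_reducedTheta τ t c
  rw [hconv] at hc hi
  refine ⟨(integrable_comp_div_iff _ two_ne_zero).mp hc, ?_⟩
  rw [Measure.integral_comp_div (fun ρ : ℝ => cexp (t * I * ρ) * zetaKernel τ ρ),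
    ContinuousLinearMap.mul_apply', ← mellin_eq_integral_exp (fun u => (reducedTheta u : ℂ)),
    ← mellin_eq_integral_exp (fun u => (reducedTheta u : ℂ)),
    (hasMellin_reducedTheta hz0 hz1).2, (hasMellin_reducedTheta hw0 hw1).2,
    ← completedRiemannZeta_one_sub (2 * w)] at hi
  -- The functional equation sends the second factor to the conjugate point of the first, so the
  -- product is a squared modulus.
  have hzw : 1 - 2 * w = 2 * conj z := by
    have c2 : conj (2 : ℂ) = 2 := Complex.conj_ofNat 2
    simp [hz, hw, c2]; ring
  rw [hzw, completedRiemannZeta_two_mul_conj hz0 hz1, Complex.mul_conj,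
    show 2 * z = 1 / 2 + τ + t * I by rw [hz]; ring] at hi
  rw [← hi]; simp

lemma integral_exp_neg_mul_cos_Ioi {b : ℝ} (hb : 0 < b) (t : ℝ) :
    IntegrableOn (fun ρ => Real.cos (t * ρ) * rexp (-(b * ρ))) (Ioi 0) ∧
    ∫ ρ in Ioi 0, Real.cos (t * ρ) * rexp (-(b * ρ)) = b / (b ^ 2 + t ^ 2) := by
  have ha : (-b + t * I : ℂ).re < 0 := by simpa using hb
  have hi := integrableOn_exp_mul_complex_Ioi ha 0
  have h := integral_exp_mul_complex_Ioi ha 0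
  have e (x : ℝ) : RCLike.re (cexp ((-b + t * I : ℂ) * x)) = Real.cos (t * x) * rexp (-(b * x)) := by
    simp [Complex.exp_re, mul_comm]
  have hr := hi.re
  have hv := integral_re hi
  simp only [e] at hr hv
  refine ⟨hr, hv.trans ?_⟩
  rw [h]
  simp [Complex.div_re, Complex.normSq_apply]
  ring

/-- The symmetric Fourier integral, folded to a half line. -/
lemma integral_cos_mul_zetaKernel {τ : ℝ} (h0 : 0 < τ) (h1 : τ < 1 / 2) (t : ℝ) :
    IntegrableOn (fun ρ => Real.cos (t * ρ) * zetaKernel τ ρ) (Ioi 0) ∧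
    4 * ∫ ρ in Ioi 0, Real.cos (t * ρ) * zetaKernel τ ρ =
      normSq (completedRiemannZeta (1 / 2 + τ + t * I)) := by
  obtain ⟨hi, h⟩ := integral_exp_mul_zetaKernel h0 h1 t
  have e (x : ℝ) : RCLike.re (cexp (t * I * x) * zetaKernel τ x) =
      Real.cos (t * x) * zetaKernel τ x := by
    rw [RCLike.re_to_complex, re_mul_ofReal, show (t * I * x : ℂ) = (t * x : ℝ) * I by
      push_cast; ring, exp_ofReal_mul_I_re]
  have hr := hi.re
  have hv := integral_re hi
  simp only [e] at hr hv
  refine ⟨hr.integrableOn, ?_⟩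
  have habs := integral_comp_abs (f := fun ρ => Real.cos (t * ρ) * zetaKernel τ ρ)
  have e2 (x : ℝ) : Real.cos (t * |x|) * zetaKernel τ |x| = Real.cos (t * x) * zetaKernel τ x := by
    rcases abs_choice x with hx | hx <;> rw [hx]
    rw [zetaKernel_neg, mul_neg, Real.cos_neg]
  simp only [e2] at habs
  have h' := congrArg Complex.re h
  rw [ofReal_re, two_mul, add_re, ← RCLike.re_to_complex, ← hv, habs] at h'
  linarith

/-! ### Consequences of evenness at `ρ = 0` -/

lemma HasDerivAt.neg_of_even {f f' : ℝ → ℝ} (hf : ∀ x, HasDerivAt f (f' x) x)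
    (he : ∀ x, f (-x) = f x) (x : ℝ) : f' (-x) = -f' x := by
  have h := (hf (-x)).comp x (hasDerivAt_neg x)
  have e : f ∘ Neg.neg = f := funext he
  rw [e] at h
  linarith [h.unique (hf x)]

lemma HasDerivAt.even_of_odd {f f' : ℝ → ℝ} (hf : ∀ x, HasDerivAt f (f' x) x)
    (ho : ∀ x, f (-x) = -f x) (x : ℝ) : f' (-x) = f' x := by
  have h := (hf (-x)).comp x (hasDerivAt_neg x)
  have e : f ∘ Neg.neg = -f := funext ho
  rw [e] at h
  linarith [h.unique (hf x).neg]

lemma hasDerivAt_exp_mul_coshIntegral {τ : ℝ} (h0 : 0 ≤ τ) (h1 : τ ≤ 1) (k : ℕ) (ρ : ℝ) :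
    HasDerivAt (fun ρ => rexp ((k + 1 / 2) * ρ) * coshIntegral τ k (rexp ρ))
      ((k + 1 / 2) * (rexp ((k + 1 / 2) * ρ) * coshIntegral τ k (rexp ρ)) +
        rexp (((k + 1 : ℕ) + 1 / 2) * ρ) * coshIntegral τ (k + 1) (rexp ρ)) ρ := by
  have hF := (hasDerivAt_coshIntegral h0 h1 k (Real.exp_pos ρ)).comp ρ (Real.hasDerivAt_exp ρ)
  have hE := ((hasDerivAt_id ρ).const_mul ((k : ℝ) + 1 / 2)).exp
  refine (hE.mul hF).congr_deriv ?_
  have : rexp (((k + 1 : ℕ) + 1 / 2) * ρ) = rexp ((k + 1 / 2) * ρ) * rexp ρ := by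
    rw [← Real.exp_add]; push_cast; ring_nf
  rw [this]
  simp only [id, Function.comp_apply]
  ring

/-- The odd derivatives of `zetaKernel` at `0` vanish. -/
lemma coshIntegral_relations {τ α β : ℝ} (h0 : 0 ≤ τ) (h1 : τ ≤ 1)
    (h : ∀ ρ, zetaKernel τ ρ = rexp (ρ / 2) * coshIntegral τ 0 (rexp ρ)
      - α * rexp (-((1 / 2 + τ) * ρ)) - β * rexp (-((1 / 2 - τ) * ρ))) :
    coshIntegral τ 0 1 / 2 + coshIntegral τ 1 1 + α * (1 / 2 + τ) + β * (1 / 2 - τ) = 0 ∧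
    coshIntegral τ 0 1 / 8 + 13 / 4 * coshIntegral τ 1 1 + 9 / 2 * coshIntegral τ 2 1 +
      coshIntegral τ 3 1 + α * (1 / 2 + τ) ^ 3 + β * (1 / 2 - τ) ^ 3 = 0 := by
  set u : ℕ → ℝ → ℝ := fun k ρ => rexp ((k + 1 / 2) * ρ) * coshIntegral τ k (rexp ρ) with hu
  have du (k : ℕ) (ρ : ℝ) : HasDerivAt (u k) ((k + 1 / 2) * u k ρ + u (k + 1) ρ) ρ :=
    hasDerivAt_exp_mul_coshIntegral h0 h1 k ρ
  have du0 (ρ : ℝ) : HasDerivAt (u 0) (1 / 2 * u 0 ρ + u 1 ρ) ρ := by simpa using du 0 ρ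
  have du1 (ρ : ℝ) : HasDerivAt (u 1) (3 / 2 * u 1 ρ + u 2 ρ) ρ :=
    (du 1 ρ).congr_deriv (by norm_num)
  have du2 (ρ : ℝ) : HasDerivAt (u 2) (5 / 2 * u 2 ρ + u 3 ρ) ρ :=
    (du 2 ρ).congr_deriv (by norm_num)
  have dE (b ρ : ℝ) : HasDerivAt (fun ρ => rexp (-(b * ρ))) (-b * rexp (-(b * ρ))) ρ := by
    refine ((hasDerivAt_id ρ).const_mul b).neg.exp.congr_deriv ?_
    simp only [id, Pi.neg_apply]; ring
  set b := 1 / 2 + τ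
  set c := 1 / 2 - τ
  -- The coefficients below come from iterating `u_k' = (k + 1/2) u_k + u_(k+1)` from `u_0`.
  set h' : ℝ → ℝ := fun ρ => 1 / 2 * u 0 ρ + u 1 ρ + α * b * rexp (-(b * ρ))
    + β * c * rexp (-(c * ρ)) with hh'
  set h'' : ℝ → ℝ := fun ρ => 1 / 4 * u 0 ρ + 2 * u 1 ρ + u 2 ρ - α * b ^ 2 * rexp (-(b * ρ))
    - β * c ^ 2 * rexp (-(c * ρ)) with hh''
  set h''' : ℝ → ℝ := fun ρ => 1 / 8 * u 0 ρ + 13 / 4 * u 1 ρ + 9 / 2 * u 2 ρ + u 3 ρ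
    + α * b ^ 3 * rexp (-(b * ρ)) + β * c ^ 3 * rexp (-(c * ρ)) with hh'''
  have d1 (ρ : ℝ) : HasDerivAt (zetaKernel τ) (h' ρ) ρ := by
    have e : zetaKernel τ = fun ρ => u 0 ρ - α * rexp (-(b * ρ)) - β * rexp (-(c * ρ)) := by
      ext ρ
      rw [h ρ]
      simp only [hu, Nat.cast_zero, zero_add]
      rw [div_mul_eq_mul_div, one_mul]
    rw [e]
    refine (((du0 ρ).sub ((dE b ρ).const_mul α)).sub ((dE c ρ).const_mul β)).congr_deriv ?_
    simp only [hh']; ring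
  have d2 (ρ : ℝ) : HasDerivAt h' (h'' ρ) ρ := by
    refine (((((du0 ρ).const_mul (1 / 2)).add (du1 ρ)).add ((dE b ρ).const_mul (α * b))).add
      ((dE c ρ).const_mul (β * c))).congr_deriv ?_
    simp only [hh'']; ring
  have d3 (ρ : ℝ) : HasDerivAt h'' (h''' ρ) ρ := by
    refine ((((((du0 ρ).const_mul (1 / 4)).add ((du1 ρ).const_mul 2)).add (du2 ρ)).sub
      ((dE b ρ).const_mul (α * b ^ 2))).sub ((dE c ρ).const_mul (β * c ^ 2))).congr_deriv ?_
    simp only [hh''']; ring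
  have o1 := HasDerivAt.neg_of_even d1 (zetaKernel_neg τ)
  have o3 := HasDerivAt.neg_of_even d3 (HasDerivAt.even_of_odd d2 o1)
  have z1 := o1 0
  have z3 := o3 0
  rw [neg_zero] at z1 z3
  simp only [hh', hh''', hu, mul_zero, Real.exp_zero, one_mul, neg_zero, mul_one] at z1 z3
  constructor <;> linarith

/-- `|Λ|²` on vertical lines through the half-line cosine integral. -/
lemma normSq_completedRiemannZeta_eq {τ α β : ℝ} (h0 : 0 < τ) (h1 : τ < 1 / 2)
    (h : ∀ ρ, zetaKernel τ ρ = rexp (ρ / 2) * coshIntegral τ 0 (rexp ρ)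
      - α * rexp (-((1 / 2 + τ) * ρ)) - β * rexp (-((1 / 2 - τ) * ρ))) (t : ℝ) :
    normSq (completedRiemannZeta (1 / 2 + τ + t * I)) =
      4 * (∫ ρ in Ioi 0, Real.cos (t * ρ) * (rexp (ρ / 2) * coshIntegral τ 0 (rexp ρ))) -
      4 * α * ((1 / 2 + τ) / ((1 / 2 + τ) ^ 2 + t ^ 2)) -
      4 * β * ((1 / 2 - τ) / ((1 / 2 - τ) ^ 2 + t ^ 2)) := by
  obtain ⟨hi, hv⟩ := integral_cos_mul_zetaKernel h0 h1 t
  obtain ⟨bi, bv⟩ := integral_exp_neg_mul_cos_Ioi (b := 1 / 2 + τ) (by linarith) t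
  obtain ⟨ci, cv⟩ := integral_exp_neg_mul_cos_Ioi (b := 1 / 2 - τ) (by linarith) t
  have e (ρ : ℝ) : Real.cos (t * ρ) * (rexp (ρ / 2) * coshIntegral τ 0 (rexp ρ)) =
      Real.cos (t * ρ) * zetaKernel τ ρ + α * (Real.cos (t * ρ) * rexp (-((1 / 2 + τ) * ρ))) +
      β * (Real.cos (t * ρ) * rexp (-((1 / 2 - τ) * ρ))) := by
    rw [h ρ]; ring
  simp only [e]
  rw [integral_add (by exact hi.add (bi.const_mul α)) (ci.const_mul β),
    integral_add hi (bi.const_mul α), integral_const_mul, integral_const_mul, bv, cv, ← hv]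
  ring

/-! ### The three integrals of the criterion -/

lemma etaWeight_nonneg {τ y : ℝ} (hy : 0 ≤ y) : 0 ≤ etaWeight τ y := by
  unfold etaWeight; positivity

lemma continuousOn_etaWeight {τ : ℝ} : ContinuousOn (etaWeight τ) (Ioi 1) := by
  have hpos (y : ℝ) (hy : y ∈ Ioi (1 : ℝ)) : 0 < √(y ^ 2 - 1) :=
    Real.sqrt_pos.mpr (by nlinarith [mem_Ioi.mp hy])
  have hne (y : ℝ) (hy : y ∈ Ioi (1 : ℝ)) : y + √(y ^ 2 - 1) ≠ 0 := by
    have := hpos y hy; have := mem_Ioi.mp hy; positivity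
  have hc : ContinuousOn (fun y : ℝ => √(y ^ 2 - 1)) (Ioi 1) := by fun_prop
  exact (((continuousOn_id.add hc).rpow_const fun y hy => Or.inl (hne y hy)).add
    ((continuousOn_id.add hc).rpow_const fun y hy => Or.inl (hne y hy))).div hc
    fun y hy => (hpos y hy).ne'

section
variable {τ : ℝ} (h0 : 0 ≤ τ) (h1 : τ ≤ 1)
include h0 h1

lemma integral_kernelB : IntegrableOn (kernelB τ) (Ioi 1) ∧
    ∫ y in Ioi 1, kernelB τ y = 2 * coshIntegral τ 1 1 + coshIntegral τ 0 1 := by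
  have i (k : ℕ) := integrable_coshIntegrand h0 h1 k k one_pos
  have i0 := i 0
  have i1 := (i 1).const_mul 2
  have e (d : ℝ) : (2 * Real.cosh d * calJDeriv τ 1 (Real.cosh d) + calJDeriv τ 0 (Real.cosh d)) *
      rexp (τ * d) = 2 * (Real.cosh d ^ 1 * calJDeriv τ 1 (1 * Real.cosh d) * rexp (τ * d)) +
      Real.cosh d ^ 0 * calJDeriv τ 0 (1 * Real.cosh d) * rexp (τ * d) := by
    rw [one_mul]; ring
  obtain ⟨hint, hval⟩ := integral_mul_etaWeight (τ := τ)
    (H := fun y => 2 * y * calJDeriv τ 1 y + calJDeriv τ 0 y) (by simp only [e]; exact i1.add i0)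
  have hk : EqOn (fun y => (2 * y * calJDeriv τ 1 y + calJDeriv τ 0 y) * etaWeight τ y)
      (kernelB τ) (Ioi 1) := by
    intro y hy
    have hy0 : 0 < y := one_pos.trans hy
    have := iteratedDeriv_calJ_eqOn h0 h1 1 hy0
    rw [iteratedDeriv_one] at this
    simp only [kernelB, this, calJ_eq_calJDeriv h0 h1 hy0]
  refine ⟨hint.congr_fun hk measurableSet_Ioi, ?_⟩
  rw [← setIntegral_congr_fun measurableSet_Ioi hk, hval]
  simp only [e]
  rw [integral_add i1 i0, integral_const_mul]
  rfl

lemma integral_kernelC : IntegrableOn (kernelC τ) (Ioi 1) ∧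
    ∫ y in Ioi 1, kernelC τ y =
      2 * coshIntegral τ 3 1 + 9 * coshIntegral τ 2 1 + 6 * coshIntegral τ 1 1 := by
  have i (k : ℕ) := integrable_coshIntegrand h0 h1 k k one_pos
  have i1 := (i 1).const_mul 6
  have i2 := (i 2).const_mul 9
  have i3 := (i 3).const_mul 2
  have e (d : ℝ) : (Real.cosh d * (2 * Real.cosh d ^ 2 * calJDeriv τ 3 (Real.cosh d) +
      9 * Real.cosh d * calJDeriv τ 2 (Real.cosh d) + 6 * calJDeriv τ 1 (Real.cosh d))) *
      rexp (τ * d) = 2 * (Real.cosh d ^ 3 * calJDeriv τ 3 (1 * Real.cosh d) * rexp (τ * d)) +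
      9 * (Real.cosh d ^ 2 * calJDeriv τ 2 (1 * Real.cosh d) * rexp (τ * d)) +
      6 * (Real.cosh d ^ 1 * calJDeriv τ 1 (1 * Real.cosh d) * rexp (τ * d)) := by
    rw [one_mul]; ring
  obtain ⟨hint, hval⟩ := integral_mul_etaWeight (τ := τ)
    (H := fun y => y * (2 * y ^ 2 * calJDeriv τ 3 y + 9 * y * calJDeriv τ 2 y +
      6 * calJDeriv τ 1 y)) (by simp only [e]; exact (i3.add i2).add i1)
  have hk : EqOn (fun y => y * (2 * y ^ 2 * calJDeriv τ 3 y + 9 * y * calJDeriv τ 2 y +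
      6 * calJDeriv τ 1 y) * etaWeight τ y) (kernelC τ) (Ioi 1) := by
    intro y hy
    have hy0 : 0 < y := one_pos.trans hy
    have := iteratedDeriv_calJ_eqOn h0 h1 1 hy0
    rw [iteratedDeriv_one] at this
    simp only [kernelC, this, iteratedDeriv_calJ_eqOn h0 h1 _ hy0]
  refine ⟨hint.congr_fun hk measurableSet_Ioi, ?_⟩
  rw [← setIntegral_congr_fun measurableSet_Ioi hk, hval]
  simp only [e]
  rw [integral_add (by exact i3.add i2) i1, integral_add i3 i2, integral_const_mul,
    integral_const_mul, integral_const_mul]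
  rfl

lemma integrableOn_kernelA (t : ℝ) :
    IntegrableOn (kernelA τ t) (Ioi 1 ×ˢ Ioi 1) := by
  obtain ⟨C, hC, hb⟩ := exists_norm_calJDeriv_le h0 h1 0 one_pos
  have hX : IntegrableOn (fun x : ℝ => C * rexp (-(π / 2) * x)) (Ioi 1) :=
    (integrableOn_exp_mul_Ioi (by linarith [Real.pi_pos]) 1).const_mul C
  have hY : IntegrableOn (fun y : ℝ => rexp (-(π / 2 * y)) * etaWeight τ y) (Ioi 1) := by
    refine (integral_mul_etaWeight (H := fun y => rexp (-(π / 2 * y))) ?_).1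
    simpa using integrable_cosh_pow_mul_exp 0 (half_pos Real.pi_pos) τ
  have hXY := Integrable.mul_prod hX hY
  rw [Measure.prod_restrict] at hXY
  have hm : MeasurableSet (Ioi (1 : ℝ) ×ˢ Ioi (1 : ℝ)) := measurableSet_Ioi.prod measurableSet_Ioi
  have hJ : ContinuousOn (calJ τ) (Ioi 0) := (contDiffOn_calJ h0 h1 0).continuousOn
  have hcont : ContinuousOn (kernelA τ t) (Ioi 1 ×ˢ Ioi 1) := by
    refine ContinuousOn.mul (ContinuousOn.mul ?_ ?_) ?_
    · refine Real.continuous_cos.comp_continuousOn (continuousOn_const.mul ?_)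
      exact continuousOn_fst.log fun p hp => (one_pos.trans hp.1).ne'
    · refine hJ.comp (by fun_prop) fun p hp => ?_
      exact mul_pos (pow_pos (one_pos.trans (mem_Ioi.mp hp.1)) 2) (one_pos.trans (mem_Ioi.mp hp.2))
    · exact continuousOn_etaWeight.comp continuousOn_snd fun p hp => hp.2
  refine Integrable.mono' hXY (hcont.aestronglyMeasurable hm) ?_
  refine (ae_restrict_iff' hm).mpr (ae_of_all _ fun p hp => ?_)
  have hx : 1 < p.1 := hp.1
  have hy : 1 < p.2 := hp.2
  -- This bound separates the variables in the exponential majorant.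
  have hxy : (p.1 + p.2) / 2 ≤ p.1 ^ 2 * p.2 := by
    have a1 : p.1 ≤ p.1 ^ 2 * p.2 := by nlinarith [mul_pos (sub_pos.mpr hx) (sub_pos.mpr hy)]
    have a2 : p.2 ≤ p.1 ^ 2 * p.2 :=
      le_mul_of_one_le_left (by linarith) (one_le_pow₀ hx.le)
    linarith
  have hη := etaWeight_nonneg (τ := τ) (one_pos.trans hy).le
  rw [kernelA, norm_mul, norm_mul, Real.norm_of_nonneg hη,
    calJ_eq_calJDeriv h0 h1 (y := p.1 ^ 2 * p.2) (by positivity)]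
  calc _ ≤ 1 * (C * rexp (-(π * (p.1 ^ 2 * p.2)))) * etaWeight τ p.2 := by
        gcongr
        · exact Real.abs_cos_le_one _
        · exact hb _ (by nlinarith)
    _ ≤ 1 * (C * rexp (-(π * ((p.1 + p.2) / 2)))) * etaWeight τ p.2 := by gcongr
    _ = _ := by
        rw [show -(π * ((p.1 + p.2) / 2)) = -(π / 2) * p.1 + -(π / 2 * p.2) by ring, Real.exp_add]
        ring

lemma integral_calJ_mul_etaWeight {q : ℝ} (hq : 0 < q) :
    ∫ y in Ioi 1, calJ τ (q * y) * etaWeight τ y = coshIntegral τ 0 q := by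
  have e (d : ℝ) : calJ τ (q * Real.cosh d) * rexp (τ * d) =
      Real.cosh d ^ 0 * calJDeriv τ 0 (q * Real.cosh d) * rexp (τ * d) := by
    rw [calJ_eq_calJDeriv h0 h1 (mul_pos hq (Real.cosh_pos d)), pow_zero, one_mul]
  rw [(integral_mul_etaWeight (H := fun y => calJ τ (q * y)) ?_).2]
  · simp only [e]; rfl
  · simp only [e]; exact integrable_coshIntegrand h0 h1 0 0 hq

/-- Fubini, then `x = exp(ρ/2)`, whose Jacobian supplies both the `1/2` and the factor `exp(ρ/2)`.
-/
lemma integral_kernelA (t : ℝ) :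
    ∫ p in Ioi 1 ×ˢ Ioi 1, kernelA τ t p =
      1 / 2 * ∫ ρ in Ioi 0, Real.cos (t * ρ) * (rexp (ρ / 2) * coshIntegral τ 0 (rexp ρ)) := by
  have hi := integrableOn_kernelA h0 h1 t
  rw [Measure.volume_eq_prod] at hi ⊢
  rw [setIntegral_prod _ hi]
  have e1 : ∀ x ∈ Ioi (1 : ℝ), ∫ y in Ioi 1, kernelA τ t (x, y) =
      Real.cos (2 * t * Real.log x) * coshIntegral τ 0 (x ^ 2) := by
    intro x hx
    rw [← integral_calJ_mul_etaWeight h0 h1 (pow_pos (one_pos.trans hx) 2), ← integral_const_mul]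
    simp only [kernelA, mul_assoc]
  rw [setIntegral_congr_fun measurableSet_Ioi e1]
  have himg : (fun ρ : ℝ => rexp (ρ / 2)) '' Ioi 0 = Ioi 1 := by
    ext x
    constructor
    · rintro ⟨ρ, hρ, rfl⟩
      exact Real.one_lt_exp_iff.mpr (half_pos hρ)
    · intro hx
      have hx0 : 0 < x := one_pos.trans hx
      exact ⟨2 * Real.log x, mul_pos two_pos (Real.log_pos hx), by
        simp only [mul_div_cancel_left₀ _ (two_ne_zero' ℝ), Real.exp_log hx0]⟩
  have hd : ∀ ρ ∈ Ioi (0 : ℝ), HasDerivWithinAt (fun ρ : ℝ => rexp (ρ / 2)) (rexp (ρ / 2) * (1 / 2))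
      (Ioi 0) ρ := fun ρ _ => ((hasDerivAt_id ρ).div_const 2).exp.hasDerivWithinAt
  have hinj : InjOn (fun ρ : ℝ => rexp (ρ / 2)) (Ioi 0) := fun a _ b _ h => by
    have := Real.exp_injective h
    linarith
  rw [← himg, integral_image_eq_integral_abs_deriv_smul measurableSet_Ioi hd hinj,
    ← integral_const_mul]
  congr 1 with ρ
  rw [abs_of_pos (by positivity), Real.log_exp, smul_eq_mul, ← Real.exp_nat_mul,
    show ((2 : ℕ) : ℝ) * (ρ / 2) = ρ by push_cast; ring, show 2 * t * (ρ / 2) = t * ρ by ring]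
  ring

end

/-! ### The identity with `|Λ|²` and the Riemann hypothesis -/

/-- The criterion's right-hand side is a positive multiple of `|Λ(1/2 + τ + it)|²`. -/
lemma criterion_eq_normSq {τ : ℝ} (h0 : 0 < τ) (h1 : τ < 1 / 2) (t : ℝ) :
    4 * ((t ^ 2 + τ ^ 2 + 1 / 4) ^ 2 - τ ^ 2) *
        (∫ p in Ioi (1 : ℝ) ×ˢ Ioi (1 : ℝ), kernelA τ t p)
      + (t ^ 2 + 2 * τ ^ 2 + 1 / 4) * (∫ y in Ioi (1 : ℝ), kernelB τ y)
      - ∫ y in Ioi (1 : ℝ), kernelC τ y =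
    ((1 / 2 + τ) ^ 2 + t ^ 2) * ((1 / 2 - τ) ^ 2 + t ^ 2) / 2 *
      normSq (completedRiemannZeta (1 / 2 + τ + t * I)) := by
  obtain ⟨α, β, h⟩ := zetaKernel_eq h0 h1
  have h0' := h0.le
  have h1' : τ ≤ 1 := by linarith
  obtain ⟨r1, r3⟩ := coshIntegral_relations h0' h1' h
  rw [normSq_completedRiemannZeta_eq h0 h1 h, integral_kernelA h0' h1', (integral_kernelB h0' h1').2,
    (integral_kernelC h0' h1').2]
  have hb : (1 / 2 + τ) ^ 2 + t ^ 2 ≠ 0 := by positivity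
  have hc : (1 / 2 - τ) ^ 2 + t ^ 2 ≠ 0 := by
    have : 0 < 1 / 2 - τ := by linarith
    positivity
  set X := ∫ ρ in Ioi 0, Real.cos (t * ρ) * (rexp (ρ / 2) * coshIntegral τ 0 (rexp ρ))
  have e {A B : ℝ} (hA : A ≠ 0) (hB : B ≠ 0) (p q : ℝ) :
      A * B / 2 * (4 * X - 4 * α * (p / A) - 4 * β * (q / B)) =
      2 * A * B * X - 2 * α * p * B - 2 * β * q * A := by
    field_simp
    ring
  rw [e hb hc]
  -- With `b = 1/2+τ` and `c = 1/2-τ`, `b² + c² = 2τ² + 1/2`; hence `αb(c²+t²) = αb(t²+b²+c²) -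
  -- αb³`, and symmetrically for `β`.
  linear_combination (2 * (t ^ 2 + 2 * τ ^ 2 + 1 / 2)) * r1 - 2 * r3

lemma completedRiemannZeta_ne_zero_iff {s : ℂ} (hs : 0 < s.re) :
    completedRiemannZeta s ≠ 0 ↔ riemannZeta s ≠ 0 := by
  have hs0 : s ≠ 0 := by rintro rfl; simp at hs
  rw [riemannZeta_def_of_ne_zero hs0, div_ne_zero_iff]
  exact (and_iff_left (Gammaℝ_ne_zero_of_re_pos hs)).symm

/-- The Riemann hypothesis as non-vanishing of `Λ` in the right half of the critical strip. -/
lemma riemannHypothesis_iff_completedRiemannZeta_ne_zero : RiemannHypothesis ↔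
    ∀ τ : ℝ, 0 < τ → τ < 1 / 2 → ∀ t : ℝ, completedRiemannZeta (1 / 2 + τ + t * I) ≠ 0 := by
  have hre (τ t : ℝ) : (1 / 2 + τ + t * I : ℂ).re = 1 / 2 + τ := by simp
  constructor
  · intro RH τ h0 h1 t
    rw [completedRiemannZeta_ne_zero_iff (by rw [hre]; linarith)]
    intro hz
    have := RH _ hz ?_ ?_
    · rw [hre] at this; linarith
    · rintro ⟨n, hn⟩
      have := congrArg Complex.re hn
      rw [hre] at this
      simp at this
      have : (0 : ℝ) ≤ n := n.cast_nonneg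
      linarith
    · intro h
      have := congrArg Complex.re h
      rw [hre, one_re] at this
      linarith
  · intro H s hz htriv _
    have main {w : ℂ} (hw : 1 / 2 < w.re) : completedRiemannZeta w ≠ 0 := by
      rcases lt_or_ge w.re 1 with h | h
      · have e : w = 1 / 2 + (w.re - 1 / 2 : ℝ) + w.im * I := by
          apply Complex.ext <;> simp
        rw [e]
        exact H _ (by linarith) (by linarith) _
      · exact (completedRiemannZeta_ne_zero_iff (by linarith)).mpr
          (riemannZeta_ne_zero_of_one_le_re h)
    have hs0 : s ≠ 0 := by
      rintro rfl
      norm_num [riemannZeta_zero] at hz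
    rw [riemannZeta_def_of_ne_zero hs0, div_eq_zero_iff] at hz
    rcases hz with hz | hz
    · by_contra hne
      rcases lt_or_gt_of_ne hne with h | h
      · rw [← completedRiemannZeta_one_sub] at hz
        exact main (by rw [sub_re, one_re]; linarith) hz
      · exact main h hz
    -- The Gamma factor only gives `s = -2n`: `n = 0` is already excluded, and `n ≥ 1` are the
    -- trivial zeros.
    · obtain ⟨n, hn⟩ := Gammaℝ_eq_zero_iff.mp hz
      cases n with
      | zero => simp at hn; exact absurd hn hs0
      | succ n => exact absurd ⟨n, by rw [hn]; push_cast; ring⟩ htriv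

/-- The first conjunct says that, for all `τ ∈ (0, 1/2)` and real `t`, every series, derivative and
integral in the inequality exists in the usual sense; the second one is the equivalence. -/
theorem theorem1p1 :
    (∀ τ : ℝ, 0 < τ → τ < 1 / 2 →
      (∀ y : ℝ, 0 < y → Summable fun p : ℕ+ × ℕ+ =>
        ((p.2 : ℝ) / (p.1 : ℝ)) ^ τ * Real.exp (-2 * Real.pi * p.1 * p.2 * y)) ∧
      ContDiffOn ℝ 3 (calJ τ) (Set.Ioi 0) ∧
      (∀ t : ℝ, MeasureTheory.IntegrableOn (kernelA τ t) (Set.Ioi 1 ×ˢ Set.Ioi 1)) ∧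
      MeasureTheory.IntegrableOn (kernelB τ) (Set.Ioi 1) ∧
      MeasureTheory.IntegrableOn (kernelC τ) (Set.Ioi 1)) ∧
    (RiemannHypothesis ↔
      ∀ τ : ℝ, 0 < τ → τ < 1 / 2 → ∀ t : ℝ,
        0 < 4 * ((t ^ 2 + τ ^ 2 + 1 / 4) ^ 2 - τ ^ 2) *
              (∫ p in Set.Ioi (1 : ℝ) ×ˢ Set.Ioi (1 : ℝ), kernelA τ t p)
            + (t ^ 2 + 2 * τ ^ 2 + 1 / 4) * (∫ y in Set.Ioi (1 : ℝ), kernelB τ y)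
            - ∫ y in Set.Ioi (1 : ℝ), kernelC τ y) := by
  refine ⟨fun τ h0 h1 => ?_, ?_⟩
  · have h0' := h0.le
    have h1' : τ ≤ 1 := by linarith
    refine ⟨fun y hy => ?_, contDiffOn_calJ h0' h1' 3, integrableOn_kernelA h0' h1',
      (integral_kernelB h0' h1').1, (integral_kernelC h0' h1').1⟩
    simpa only [calJDerivTerm, pow_zero, mul_one] using summable_calJDerivTerm h0' h1' 0 hy
  · rw [riemannHypothesis_iff_completedRiemannZeta_ne_zero]
    refine forall_congr' fun τ => forall_congr' fun h0 => forall_congr' fun h1 =>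
      forall_congr' fun t => ?_
    have hc : 0 < 1 / 2 - τ := by linarith
    rw [criterion_eq_normSq h0 h1, mul_pos_iff_of_pos_left (by positivity), normSq_pos]
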